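/- A $k$-mixed graph $\mathcal G$ has $k+1$ pairwise disjoint finite vertex parts $A_1,\dots,A_k,C$; its edges are those of a $k$-partite $k$-uniform hypergraph on $\mathcal A=(A_1,\dots,A_k)$, with edge set $E(\mathcal A)$, together with those of a bipartite graph between $C$ and $A_1\cup\dots\cup A_k$. Write $d(\mathcal A)=|E(\mathcal A)|/\prod_i|A_i|$. A vertex $c\in C$ extends $(a_1,\dots,a_k)\in E(\mathcal A)$ if $c$ is adjacent to all of $a_1,\dots,a_k$, and the minimum extension density $\tau_C(\mathcal G)$ is the minimum over all $e\in E(\mathcal A)$ of $|\{c\in C: c\text{ extends }e\}|/|C|$ (and $0$ if $E(\mathcal A)=\varnothing$). **Lemma.** For every integer $k\ge 2$ and every real $\gamma\in(0,\tfrac12]$ there is a real $\zeta\ge\gamma^{k^{50}\gamma^{-10}}>0$ such that the following holds. Let $N\ge 1$ and let $G$ be an $N$-vertex graph with at least $\gamma N^{k+1}$ (unlabeled) copies of $K_{k+1}$. Then there exist pairwise disjoint sets $A_1,\dots,A_k,C\subseteq V(G)$, each of size at least $\lfloor\zeta N\rfloor$, a $k$-mixed graph $\mathcal G$ with parts $A_1,\dots,A_k,C$,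 and a real $\tau\in[\gamma^{2/(k+1)},\tfrac12]$ such that 1. every edge of $\mathcal G$ between $C$ and $A_1\cup\dots\cup A_k$ is an edge of $G$; 2. the vertices of every edge in $E(\mathcal A)$ form a copy of $K_k$ in $G$; 3. $\tau_C(\mathcal G)\ge\tau\ge\gamma^{2/(k+1)}$ and $d(\mathcal A)\,\tau\ge\gamma/4$. -/

import Mathlib

/-- A `k`-mixed graph with pairwise disjoint finite parts `A 0, …, A (k-1), C` inside a vertex
type `V`: a `k`-partite `k`-graph on `(A 0, …, A (k-1))` together with a bipartite graph between
`C` and the union of the `A i`. As the parts are disjoint, a `k`-edge is recorded as the tuple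
listing its vertex in each part. -/
structure MixedGraph (k : ℕ) (V : Type*) where
  A : Fin k → Finset V
  C : Finset V
  disjoint_A : ∀ i j, i ≠ j → Disjoint (A i) (A j)
  disjoint_C : ∀ i, Disjoint (A i) C
  edges : Finset (Fin k → V)
  mem_of_edge : ∀ e ∈ edges, ∀ i, e i ∈ A i
  graph : SimpleGraph V
  bipartite : ∀ u v, graph.Adj u v →
    (u ∈ C ∧ ∃ i, v ∈ A i) ∨ (v ∈ C ∧ ∃ i, u ∈ A i)

namespace MixedGraph

variable {k : ℕ} {V : Type*}

/-- The vertex `c` extends the tuple `e` if it is adjacent to all the vertices of `e`. -/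
def Extends (M : MixedGraph k V) (c : V) (e : Fin k → V) : Prop :=
  ∀ i, M.graph.Adj c (e i)

open Classical in
/-- The vertices of `C` that extend `e`. -/
noncomputable def extensions (M : MixedGraph k V) (e : Fin k → V) : Finset V :=
  M.C.filter fun c => M.Extends c e

/-- The minimum extension density: the minimum, over all `k`-edges `e`, of the fraction of
vertices of `C` that extend `e`; it is `0` if there is no `k`-edge. -/
noncomputable def minExtDensity (M : MixedGraph k V) : ℝ :=
  if h : M.edges.Nonempty then
    M.edges.inf' h fun e => ((M.extensions e).card : ℝ) / (M.C.card : ℝ)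
  else 0

/-- The edge density of the `k`-partite `k`-graph on `(A 0, …, A (k-1))`. -/
noncomputable def density (M : MixedGraph k V) : ℝ :=
  (M.edges.card : ℝ) / ∏ i, ((M.A i).card : ℝ)

end MixedGraph

/-! Put n = k + 1. A random n-colouring of the vertices gives disjoint parts whose density of
transversal `K_n`-tuples is at least n!γ. Each clique yields n! tuples, each tuple survives with
probability n^(-n), and AM-GM bounds the product of the part sizes by (N/n)^n.

Next, pass to subsets of the parts on which every pair is regular in the cut norm. A single tuple
suffices, so no vertex partition is built. Among all nonempty subtuples, maximise the clique density
plus c times the sum of squared pair densities plus α times the logarithm of the volume. If some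
pair were irregular, convexity of the square would give one of four sub-boxes too large a value.
Comparison with the initial tuple shows that the maximiser keeps nearly all the clique density and
loses only a factor exp(-2/α) of volume, with α polynomial in γ and 1/n.

Cut regularity gives counting with additive errors, and these need only be small against γ, so ε may
be polynomial in γ. Let D be the product of all pair densities, which is about the clique density or
more. Let p_c be the product of the densities at part c. Every pair lies in two stars, so the
product of the p_c is D^2, and the largest, p, satisfies p^n ≥ D^2. Take that part as C and put τ =
p/2. Keep the transversal k-cliques with at least τ|C| extensions. The average number of extensions
over any set of tuples is about p|C|, so the discarded cliques are few after weighting by p. Hence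
d(𝒜)p is at least the clique density minus 3kε. -/

section Counting

/-! ### Counting in cut-regular tuples -/

open scoped Classical in
/-- The number of tuples in `∏ i, W i` that satisfy `h`. -/
noncomputable def tupleCount {ι V : Type*} [Fintype ι] [DecidableEq ι]
    (W : ι → Finset V) (h : (ι → V) → Prop) : ℝ :=
  ∑ x ∈ Fintype.piFinset W, if h x then 1 else 0

/-- The number of tuples in `∏ i, W i`. -/
noncomputable def boxVolume {ι V : Type*} [Fintype ι] (W : ι → Finset V) : ℝ :=
  ∏ i, ((W i).card : ℝ)

/-- The proportion of pairs in `W i × W j` that are edges, measured on tuples. -/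
noncomputable def pairDensity {ι V : Type*} [Fintype ι] [DecidableEq ι]
    (G : SimpleGraph V) (W : ι → Finset V) (i j : ι) : ℝ :=
  tupleCount W (fun x => G.Adj (x i) (x j)) / boxVolume W

open scoped Classical in
/-- Cut-norm regularity of the pair `(W i, W j)`. -/
def CutRegular {ι V : Type*} [Fintype ι] [DecidableEq ι]
    (G : SimpleGraph V) (ε : ℝ) (W : ι → Finset V) (i j : ι) : Prop :=
  ∀ U ⊆ W i, ∀ U' ⊆ W j,
    |∑ a ∈ U, ∑ b ∈ U', ((if G.Adj a b then (1 : ℝ) else 0) - pairDensity G W i j)| ≤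
      ε * ((W i).card * (W j).card)

/-- The weight `h` factors as a product of functions of the `i`th and of the `j`th coordinate
once the other coordinates are fixed. -/
def FactorsOver {ι V : Type*} [DecidableEq ι] (h : (ι → V) → Prop) (i j : ι) : Prop :=
  ∀ x, ∃ P Q : V → Prop, ∀ a b,
    h (Function.update (Function.update x i a) j b) ↔ P a ∧ Q b

set_option linter.unusedSectionVars false

variable {ι V : Type*} [Fintype ι] [DecidableEq ι]

theorem boxVolume_eq_card (W : ι → Finset V) :
    boxVolume W = (Fintype.piFinset W).card := by
  simp [boxVolume, Fintype.card_piFinset]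

theorem boxVolume_nonneg (W : ι → Finset V) : 0 ≤ boxVolume W :=
  Finset.prod_nonneg fun _ _ => Nat.cast_nonneg _

theorem boxVolume_pos {W : ι → Finset V} (hW : ∀ i, (W i).Nonempty) : 0 < boxVolume W :=
  Finset.prod_pos fun i _ => by exact_mod_cast (hW i).card_pos

theorem boxVolume_mono {W W' : ι → Finset V} (h : ∀ i, W' i ⊆ W i) :
    boxVolume W' ≤ boxVolume W :=
  Finset.prod_le_prod (fun _ _ => Nat.cast_nonneg _)
    fun i _ => by exact_mod_cast Finset.card_le_card (h i)

theorem nonempty_of_boxVolume_ne_zero {W : ι → Finset V} (h : boxVolume W ≠ 0) (i : ι) :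
    (W i).Nonempty := by
  rw [Finset.nonempty_iff_ne_empty]
  intro h0
  exact h (Finset.prod_eq_zero (Finset.mem_univ i) (by simp [h0]))

theorem tupleCount_nonneg (W : ι → Finset V) (h : (ι → V) → Prop) : 0 ≤ tupleCount W h :=
  Finset.sum_nonneg fun _ _ => by split_ifs <;> norm_num

theorem tupleCount_le (W : ι → Finset V) (h : (ι → V) → Prop) :
    tupleCount W h ≤ boxVolume W := by
  rw [boxVolume_eq_card, tupleCount]
  calc _ ≤ ∑ x ∈ Fintype.piFinset W, (1 : ℝ) :=
        Finset.sum_le_sum fun _ _ => by split_ifs <;> norm_num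
    _ = _ := by simp

theorem pairDensity_nonneg (G : SimpleGraph V) (W : ι → Finset V) (i j : ι) :
    0 ≤ pairDensity G W i j :=
  div_nonneg (tupleCount_nonneg _ _) (boxVolume_nonneg _)

theorem pairDensity_le_one (G : SimpleGraph V) (W : ι → Finset V) (i j : ι) :
    pairDensity G W i j ≤ 1 :=
  div_le_one_of_le₀ (tupleCount_le _ _) (boxVolume_nonneg _)

theorem pairDensity_comm (G : SimpleGraph V) (W : ι → Finset V) (i j : ι) :
    pairDensity G W i j = pairDensity G W j i := by
  simp only [pairDensity, G.adj_comm]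

open scoped Classical in
theorem CutRegular.symm {G : SimpleGraph V} {ε : ℝ} {W : ι → Finset V} {i j : ι}
    (h : CutRegular G ε W i j) : CutRegular G ε W j i := by
  intro U hU U' hU'
  have := h U' hU' U hU
  rw [Finset.sum_comm, mul_comm ((W j).card : ℝ), pairDensity_comm]
  refine le_of_eq_of_le (congrArg _ ?_) this
  exact Finset.sum_congr rfl fun a _ => Finset.sum_congr rfl fun b _ => 
    congrArg (fun z : ℝ => z - pairDensity G W i j) (if_congr (G.adj_comm b a) rfl rfl)

/-- Resampling one coordinate. -/
theorem sum_piFinset_update (W : ι → Finset V) (i : ι) (U : Finset V) (F : (ι → V) → ℝ) :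
    ∑ x ∈ Fintype.piFinset W, ∑ a ∈ U, F (Function.update x i a) =
      (W i).card * ∑ x ∈ Fintype.piFinset (Function.update W i U), F x := by
  have h1 : ((W i).card : ℝ) * ∑ x ∈ Fintype.piFinset (Function.update W i U), F x =
      ∑ x ∈ Fintype.piFinset (Function.update W i U), ∑ _a ∈ W i, F x := by
    rw [Finset.mul_sum]; simp
  rw [h1, ← Finset.sum_product', ← Finset.sum_product']
  -- Exchanging the old value at `i` with the new one is its own inverse.
  refine Finset.sum_nbij' (fun p => (Function.update p.1 i p.2, p.1 i))
    (fun p => (Function.update p.1 i p.2, p.1 i)) ?_ ?_ ?_ ?_ ?_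
  · rintro ⟨x, a⟩ h
    simp only [Finset.mem_product, Fintype.mem_piFinset] at h ⊢
    refine ⟨fun j => ?_, h.1 i⟩
    by_cases hj : j = i
    · subst hj; simpa using h.2
    · simpa [hj] using h.1 j
  · rintro ⟨x, a⟩ h
    simp only [Finset.mem_product, Fintype.mem_piFinset] at h ⊢
    refine ⟨fun j => ?_, by simpa using h.1 i⟩
    by_cases hj : j = i
    · subst hj; simpa using h.2
    · simpa [hj] using h.1 j
  · rintro ⟨x, a⟩ _; simp
  · rintro ⟨x, a⟩ _; simp
  · rintro ⟨x, a⟩ _; rfl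

/-- Resampling two coordinates. -/
theorem sum_piFinset_update_update (W : ι → Finset V) {i j : ι} (hij : i ≠ j)
    (U U' : Finset V) (F : (ι → V) → ℝ) :
    ∑ x ∈ Fintype.piFinset W, ∑ a ∈ U, ∑ b ∈ U',
        F (Function.update (Function.update x i a) j b) =
      (W i).card * (W j).card *
        ∑ x ∈ Fintype.piFinset (Function.update (Function.update W i U) j U'), F x := by
  rw [sum_piFinset_update W i U (fun y => ∑ b ∈ U', F (Function.update y j b)),
    sum_piFinset_update, Function.update_of_ne hij.symm, mul_assoc]

-- Redraw coordinates `i` and `j` with all others fixed. The weight then becomes the indicator of a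
-- rectangle, to which cut regularity applies; averaging over the fixed coordinates keeps the bound.
open scoped Classical in
theorem CutRegular.abs_sum_le {G : SimpleGraph V} {ε : ℝ} {W : ι → Finset V} {i j : ι}
    (hreg : CutRegular G ε W i j) (hij : i ≠ j) (hW : ∀ i, (W i).Nonempty)
    {h : (ι → V) → Prop} (hh : FactorsOver h i j) :
    |tupleCount W (fun x => h x ∧ G.Adj (x i) (x j)) - pairDensity G W i j * tupleCount W h| ≤
      ε * boxVolume W := by
  set d := pairDensity G W i j with hd
  set F : (ι → V) → ℝ := fun x =>
    if h x then (if G.Adj (x i) (x j) then (1 : ℝ) else 0) - d else 0 with hF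
  have h1 : tupleCount W (fun x => h x ∧ G.Adj (x i) (x j)) - d * tupleCount W h =
      ∑ x ∈ Fintype.piFinset W, F x := by
    rw [tupleCount, tupleCount, Finset.mul_sum, ← Finset.sum_sub_distrib]
    refine Finset.sum_congr rfl fun x _ => ?_
    by_cases hx : h x <;> simp [hF, hx]
  have h2 := sum_piFinset_update_update W hij (W i) (W j) F
  rw [Function.update_eq_self, Function.update_eq_self] at h2
  have hpos : (0 : ℝ) < (W i).card * (W j).card := by
    have := (hW i).card_pos
    have := (hW j).card_pos
    positivity
  have h3 : |∑ x ∈ Fintype.piFinset W, ∑ a ∈ W i, ∑ b ∈ W j,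
        F (Function.update (Function.update x i a) j b)| ≤
      boxVolume W * (ε * ((W i).card * (W j).card)) := by
    refine (Finset.abs_sum_le_sum_abs _ _).trans ?_
    rw [boxVolume_eq_card, ← nsmul_eq_mul]
    refine Finset.sum_le_card_nsmul _ _ _ fun x _ => ?_
    obtain ⟨P, Q, hPQ⟩ := hh x
    have h4 := hreg ((W i).filter P) (Finset.filter_subset _ _) ((W j).filter Q)
      (Finset.filter_subset _ _)
    refine le_of_eq_of_le (congrArg _ ?_) h4
    rw [Finset.sum_filter]
    refine Finset.sum_congr rfl fun a _ => ?_
    by_cases ha : P a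
    · rw [if_pos ha, Finset.sum_filter]
      refine Finset.sum_congr rfl fun b _ => ?_
      simp [hF, hPQ, ha, Function.update_of_ne hij, hd]
    · rw [if_neg ha]
      refine Finset.sum_eq_zero fun b _ => ?_
      simp [hF, hPQ, ha]
  rw [h1]
  rw [h2, abs_mul, abs_of_pos hpos] at h3
  refine le_of_mul_le_mul_left ?_ hpos
  linarith

theorem FactorsOver.and {h h' : (ι → V) → Prop} {i j : ι} (H : FactorsOver h i j)
    (H' : FactorsOver h' i j) : FactorsOver (fun x => h x ∧ h' x) i j := by
  intro x
  obtain ⟨P, Q, h1⟩ := H x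
  obtain ⟨P', Q', h2⟩ := H' x
  refine ⟨fun a => P a ∧ P' a, fun b => Q b ∧ Q' b, fun a b => ?_⟩
  simp only [h1, h2]; tauto

theorem factorsOver_true (i j : ι) : FactorsOver (fun _ : ι → V => True) i j :=
  fun _ => ⟨fun _ => True, fun _ => True, fun _ _ => by simp⟩

theorem FactorsOver.forall_mem {κ : Type*} {s : Finset κ} {h : κ → (ι → V) → Prop} {i j : ι}
    (H : ∀ q ∈ s, FactorsOver (h q) i j) : FactorsOver (fun x => ∀ q ∈ s, h q x) i j := by
  intro x
  choose P Q hPQ using fun q (hq : q ∈ s) => H q hq x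
  refine ⟨fun a => ∀ q hq, P q hq a, fun b => ∀ q hq, Q q hq b, fun a b => ?_⟩
  constructor
  · intro h
    exact ⟨fun q hq => ((hPQ q hq a b).1 (h q hq)).1, fun q hq => ((hPQ q hq a b).1 (h q hq)).2⟩
  · intro h q hq
    exact (hPQ q hq a b).2 ⟨h.1 q hq, h.2 q hq⟩

/-- A pair other than {i, j} contains at most one of `i` and `j`, so its adjacency depends on at
most one of the two coordinates. This lets the counting lemma treat one pair at a time. -/
theorem factorsOver_adj (G : SimpleGraph V) {i j u v : ι} (hij : i ≠ j)
    (h : s(u, v) ≠ s(i, j)) (huv : u ≠ v) :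
    FactorsOver (fun x : ι → V => G.Adj (x u) (x v)) i j := by
  intro x
  simp only [ne_eq, Sym2.eq_iff, not_or, not_and] at h
  by_cases h1 : u = j
  · have hvi : v ≠ i := fun hv => h.2 h1 hv
    refine ⟨fun _ => True, fun b => G.Adj b (x v), fun a b => ?_⟩
    subst h1
    simp [Function.update_of_ne huv.symm, Function.update_of_ne hvi]
  by_cases h2 : v = j
  · have hui : u ≠ i := fun hu => h.1 hu h2
    refine ⟨fun _ => True, fun b => G.Adj (x u) b, fun a b => ?_⟩
    subst h2
    simp [Function.update_of_ne huv, Function.update_of_ne hui]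
  · refine ⟨fun a => G.Adj (Function.update x i a u) (Function.update x i a v),
      fun _ => True, fun a b => ?_⟩
    simp [Function.update_of_ne h1, Function.update_of_ne h2]

/-- The counting lemma for cut-regular pairs, with a weight. -/
theorem abs_tupleCount_sub_le {G : SimpleGraph V} {ε : ℝ}
    {W : ι → Finset V} (hW : ∀ i, (W i).Nonempty) {h : (ι → V) → Prop} (P : Finset (ι × ι))
    (hne : ∀ p ∈ P, p.1 ≠ p.2)
    (hinj : ∀ p ∈ P, ∀ q ∈ P, p ≠ q → s(p.1, p.2) ≠ s(q.1, q.2))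
    (hreg : ∀ p ∈ P, CutRegular G ε W p.1 p.2) (hh : ∀ p ∈ P, FactorsOver h p.1 p.2) :
    |tupleCount W (fun x => h x ∧ ∀ p ∈ P, G.Adj (x p.1) (x p.2)) -
        (∏ p ∈ P, pairDensity G W p.1 p.2) * tupleCount W h| ≤
      P.card * (ε * boxVolume W) := by
  induction P using Finset.induction_on with
  | empty => simp
  | insert p P hp ih =>
    have ih' := ih (fun q hq => hne q (Finset.mem_insert_of_mem hq))
      (fun q hq r hr => hinj q (Finset.mem_insert_of_mem hq) r (Finset.mem_insert_of_mem hr))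
      (fun q hq => hreg q (Finset.mem_insert_of_mem hq))
      (fun q hq => hh q (Finset.mem_insert_of_mem hq))
    have hpm := Finset.mem_insert_self p P
    have hfac : FactorsOver (fun x => h x ∧ ∀ p ∈ P, G.Adj (x p.1) (x p.2)) p.1 p.2 := by
      refine (hh p hpm).and (FactorsOver.forall_mem fun q hq => ?_)
      refine factorsOver_adj G (hne p hpm) ?_ (hne q (Finset.mem_insert_of_mem hq))
      refine hinj q (Finset.mem_insert_of_mem hq) p hpm ?_
      rintro rfl; exact hp hq
    have h1 := (hreg p hpm).abs_sum_le (hne p hpm) hW hfac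
    have h2 : (fun x : ι → V => h x ∧ ∀ q ∈ insert p P, G.Adj (x q.1) (x q.2)) =
        fun x => (h x ∧ ∀ q ∈ P, G.Adj (x q.1) (x q.2)) ∧ G.Adj (x p.1) (x p.2) := by
      funext x
      simp only [Finset.forall_mem_insert, eq_iff_iff]
      tauto
    rw [h2, Finset.prod_insert hp, Finset.card_insert_of_notMem hp]
    set d := pairDensity G W p.1 p.2
    have hd0 : 0 ≤ d := pairDensity_nonneg _ _ _ _
    have hd1 : d ≤ 1 := pairDensity_le_one _ _ _ _
    set A := tupleCount W fun x =>
      (h x ∧ ∀ q ∈ P, G.Adj (x q.1) (x q.2)) ∧ G.Adj (x p.1) (x p.2)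
    set B := tupleCount W fun x => h x ∧ ∀ q ∈ P, G.Adj (x q.1) (x q.2)
    set D := ∏ p ∈ P, pairDensity G W p.1 p.2
    set H := tupleCount W h
    -- The first term is the error of the new pair; the second is the inductive error, not enlarged
    -- since `d` is at most 1.
    have h3 : A - d * D * H = (A - d * B) + d * (B - D * H) := by ring
    rw [h3]
    refine (abs_add_le _ _).trans ?_
    rw [abs_mul, abs_of_nonneg hd0]
    have h4 : d * |B - D * H| ≤ 1 * |B - D * H| :=
      mul_le_mul_of_nonneg_right hd1 (abs_nonneg _)
    push_cast
    linarith

end Counting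

/-! ### Cut regularity by maximising a penalised energy -/

section Regularity

set_option linter.unusedSectionVars false

variable {ι V : Type*} [Fintype ι] [DecidableEq ι]

/-- All ordered pairs of distinct indices. -/
def offDiagPairs (ι : Type*) [Fintype ι] [DecidableEq ι] : Finset (ι × ι) :=
  Finset.univ.filter fun p => p.1 ≠ p.2

/-- The density of tuples satisfying `h` plus `c` times the energy. -/
noncomputable def energy (G : SimpleGraph V) (h : (ι → V) → Prop) (c : ℝ)
    (W : ι → Finset V) : ℝ :=
  tupleCount W h / boxVolume W + c * ∑ p ∈ offDiagPairs ι, pairDensity G W p.1 p.2 ^ 2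

theorem sum_sq_pairDensity_le (G : SimpleGraph V) (W : ι → Finset V) :
    ∑ p ∈ offDiagPairs ι, pairDensity G W p.1 p.2 ^ 2 ≤ (Fintype.card ι : ℝ) ^ 2 := by
  calc _ ≤ ∑ p ∈ offDiagPairs ι, (1 : ℝ) := Finset.sum_le_sum fun p _ =>
        pow_le_one₀ (pairDensity_nonneg _ _ _ _) (pairDensity_le_one _ _ _ _)
    _ = ((offDiagPairs ι).card : ℝ) := by simp
    _ ≤ (Fintype.card (ι × ι) : ℝ) := by exact_mod_cast Finset.card_le_univ _
    _ = _ := by rw [Fintype.card_prod]; push_cast; ring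

/-- Some nonempty subtuple maximises the energy with a logarithmic penalty on its volume. -/
theorem exists_max_energy (G : SimpleGraph V) (h : (ι → V) → Prop) (c α : ℝ)
    {W₀ : ι → Finset V} (hW₀ : ∀ i, (W₀ i).Nonempty) :
    ∃ W : ι → Finset V, (∀ i, W i ⊆ W₀ i) ∧ (∀ i, (W i).Nonempty) ∧
      ∀ W' : ι → Finset V, (∀ i, W' i ⊆ W₀ i) → (∀ i, (W' i).Nonempty) →
        energy G h c W' + α * Real.log (boxVolume W') ≤
          energy G h c W + α * Real.log (boxVolume W) := by
  classical
  obtain ⟨W, hW, hmax⟩ := Finset.exists_max_image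
    (Fintype.piFinset fun i => (W₀ i).powerset.filter Finset.Nonempty)
    (fun W => energy G h c W + α * Real.log (boxVolume W))
    ⟨W₀, by simpa [Fintype.mem_piFinset] using hW₀⟩
  simp only [Fintype.mem_piFinset, Finset.mem_filter, Finset.mem_powerset] at hW hmax
  exact ⟨W, fun i => (hW i).1, fun i => (hW i).2, fun W' h1 h2 => hmax W' fun i => ⟨h1 i, h2 i⟩⟩

theorem sum_piFinset_split [DecidableEq V] (W : ι → Finset V) (i : ι) {U : Finset V}
    (hU : U ⊆ W i) (F : (ι → V) → ℝ) :
    ∑ x ∈ Fintype.piFinset (Function.update W i U), F x +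
      ∑ x ∈ Fintype.piFinset (Function.update W i (W i \ U)), F x =
    ∑ x ∈ Fintype.piFinset W, F x := by
  have key : ∀ S ⊆ W i, Fintype.piFinset (Function.update W i S) =
      (Fintype.piFinset W).filter fun x => x i ∈ S := by
    intro S hS
    ext x
    simp only [Fintype.mem_piFinset, Finset.mem_filter]
    constructor
    · intro hx
      have hi : x i ∈ S := by simpa using hx i
      refine ⟨fun j => ?_, hi⟩
      by_cases hj : j = i
      · subst hj; exact hS hi
      · simpa [hj] using hx j
    · rintro ⟨hx, hi⟩ j
      by_cases hj : j = i
      · subst hj; simpa using hi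
      · simpa [hj] using hx j
  rw [key U hU, key _ Finset.sdiff_subset,
    ← Finset.sum_filter_add_sum_filter_not (Fintype.piFinset W) (fun x => x i ∈ U)]
  congr 1
  refine Finset.sum_congr (Finset.filter_congr fun x hx => ?_) fun _ _ => rfl
  simp [Fintype.mem_piFinset.1 hx i]

theorem update_subset {W : ι → Finset V} {i : ι} {U : Finset V} (hU : U ⊆ W i) (j : ι) :
    Function.update W i U j ⊆ W j := by
  by_cases hj : j = i
  · subst hj; simpa using hU
  · simp [hj]

open scoped Classical in
/-- The linearised excess of the energy of a subtuple of `W`. -/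
noncomputable def energyExcess (G : SimpleGraph V) (h : (ι → V) → Prop) (c : ℝ)
    (W : ι → Finset V) (x : ι → V) : ℝ :=
  (if h x then 1 else 0) + c * ∑ p ∈ offDiagPairs ι,
    (2 * pairDensity G W p.1 p.2 * (if G.Adj (x p.1) (x p.2) then 1 else 0) -
      pairDensity G W p.1 p.2 ^ 2) - energy G h c W

theorem sum_energyExcess (G : SimpleGraph V) (h : (ι → V) → Prop) (c : ℝ)
    (W W' : ι → Finset V) :
    ∑ x ∈ Fintype.piFinset W', energyExcess G h c W x =
      tupleCount W' h + c * ∑ p ∈ offDiagPairs ι,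
        (2 * pairDensity G W p.1 p.2 * tupleCount W' (fun x => G.Adj (x p.1) (x p.2)) -
          pairDensity G W p.1 p.2 ^ 2 * boxVolume W') - energy G h c W * boxVolume W' := by
  simp only [energyExcess, Finset.sum_sub_distrib, Finset.sum_add_distrib, ← Finset.mul_sum]
  rw [Finset.sum_comm (s := Fintype.piFinset W')]
  simp only [tupleCount, boxVolume_eq_card, Finset.sum_const, nsmul_eq_mul, ← Finset.mul_sum,
    Finset.sum_mul, mul_comm]

/-- Squares are linearised at the densities of `W` itself, where the tangent is exact. Being
additive, the excess thus sums to zero over any splitting of `W` into boxes. -/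
theorem sum_energyExcess_self (G : SimpleGraph V) (h : (ι → V) → Prop) (c : ℝ)
    {W : ι → Finset V} (hW : ∀ i, (W i).Nonempty) :
    ∑ x ∈ Fintype.piFinset W, energyExcess G h c W x = 0 := by
  have hv := (boxVolume_pos hW).ne'
  rw [sum_energyExcess, energy]
  have : ∀ p : ι × ι, 2 * pairDensity G W p.1 p.2 *
        tupleCount W (fun x => G.Adj (x p.1) (x p.2)) -
      pairDensity G W p.1 p.2 ^ 2 * boxVolume W = pairDensity G W p.1 p.2 ^ 2 * boxVolume W := by
    intro p
    have : tupleCount W (fun x => G.Adj (x p.1) (x p.2)) =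
        pairDensity G W p.1 p.2 * boxVolume W := by
      rw [pairDensity, div_mul_cancel₀ _ hv]
    rw [this]; ring
  simp only [this, ← Finset.sum_mul]
  field_simp
  ring

/-- The gap between a square and its tangent at `d` is exactly `(q - d * v) ^ 2 / v`; this is the
gain from an irregular pair. -/
theorem sub_sq_le_div (q d v V₀ : ℝ) (hv : 0 < v) (hV : v ≤ V₀) :
    2 * d * q - d ^ 2 * v + (q - d * v) ^ 2 / V₀ ≤ (q / v) ^ 2 * v := by
  have h1 : (q - d * v) ^ 2 / V₀ ≤ (q - d * v) ^ 2 / v :=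
    div_le_div_of_nonneg_left (sq_nonneg _) hv hV
  have h2 : (q / v) ^ 2 * v = 2 * d * q - d ^ 2 * v + (q - d * v) ^ 2 / v := by
    field_simp; ring
  linarith

/-- A subtuple of a maximiser has small excess, even after adding the defect of one pair. -/
theorem excess_add_defect_le {G : SimpleGraph V} {h : (ι → V) → Prop} {c α : ℝ}
    (hc : 0 ≤ c) (hα : 0 ≤ α) {W W' : ι → Finset V} (hW : ∀ i, (W i).Nonempty)
    (hsub : ∀ i, W' i ⊆ W i)
    (hmax : (∀ i, (W' i).Nonempty) → energy G h c W' + α * Real.log (boxVolume W') ≤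
      energy G h c W + α * Real.log (boxVolume W)) (p : ι × ι) (hp : p.1 ≠ p.2) :
    ∑ x ∈ Fintype.piFinset W', energyExcess G h c W x +
      c * ((tupleCount W' (fun x => G.Adj (x p.1) (x p.2)) -
        pairDensity G W p.1 p.2 * boxVolume W') ^ 2 / boxVolume W) ≤ α * boxVolume W := by
  have hV := boxVolume_pos hW
  have hle := boxVolume_mono hsub
  rw [sum_energyExcess]
  rcases (boxVolume_nonneg W').eq_or_lt with h0 | hpos
  · have hz : ∀ f, tupleCount W' f = 0 := fun f =>
      le_antisymm (by rw [h0]; exact tupleCount_le _ _) (tupleCount_nonneg _ _)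
    simp only [hz, ← h0]
    simp only [mul_zero, sub_zero, Finset.sum_const_zero, add_zero]
    norm_num
    positivity
  · have hne := nonempty_of_boxVolume_ne_zero hpos.ne'
    have h1 := hmax hne
    -- As log t ≤ t, the penalty weighted by the volume of `W'` is at most `α * boxVolume W`,
    -- however small `W'` is.
    have hlog : Real.log (boxVolume W) - Real.log (boxVolume W') ≤
        boxVolume W / boxVolume W' := by
      rw [← Real.log_div hV.ne' hpos.ne']
      have := Real.log_le_sub_one_of_pos (div_pos hV hpos)
      linarith
    have h2 : energy G h c W' ≤ energy G h c W + α * (boxVolume W / boxVolume W') := by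
      nlinarith [mul_le_mul_of_nonneg_left hlog hα]
    have h3 := mul_le_mul_of_nonneg_right h2 hpos.le
    have h4 : (energy G h c W + α * (boxVolume W / boxVolume W')) * boxVolume W' =
        energy G h c W * boxVolume W' + α * boxVolume W := by
      field_simp
    have h5 : energy G h c W' * boxVolume W' = tupleCount W' h +
        c * ∑ q ∈ offDiagPairs ι, pairDensity G W' q.1 q.2 ^ 2 * boxVolume W' := by
      rw [energy, ← Finset.sum_mul]; field_simp
    rw [h4, h5] at h3
    have hpm : p ∈ offDiagPairs ι := by simp [offDiagPairs, hp]
    have h6 : ∑ q ∈ offDiagPairs ι,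
        (2 * pairDensity G W q.1 q.2 * tupleCount W' (fun x => G.Adj (x q.1) (x q.2)) -
          pairDensity G W q.1 q.2 ^ 2 * boxVolume W') +
        (tupleCount W' (fun x => G.Adj (x p.1) (x p.2)) -
          pairDensity G W p.1 p.2 * boxVolume W') ^ 2 / boxVolume W ≤
        ∑ q ∈ offDiagPairs ι, pairDensity G W' q.1 q.2 ^ 2 * boxVolume W' := by
      have hq : ∀ q : ι × ι, _ := fun q => sub_sq_le_div
        (tupleCount W' (fun x => G.Adj (x q.1) (x q.2))) (pairDensity G W q.1 q.2)
        (boxVolume W') (boxVolume W) hpos hle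
      have hq' : ∀ q : ι × ι, 0 ≤ (tupleCount W' (fun x => G.Adj (x q.1) (x q.2)) -
          pairDensity G W q.1 q.2 * boxVolume W') ^ 2 / boxVolume W := fun q => by positivity
      calc _ ≤ ∑ q ∈ offDiagPairs ι, (2 * pairDensity G W q.1 q.2 *
              tupleCount W' (fun x => G.Adj (x q.1) (x q.2)) -
            pairDensity G W q.1 q.2 ^ 2 * boxVolume W') +
          ∑ q ∈ offDiagPairs ι, (tupleCount W' (fun x => G.Adj (x q.1) (x q.2)) -
            pairDensity G W q.1 q.2 * boxVolume W') ^ 2 / boxVolume W := by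
            gcongr
            exact Finset.single_le_sum (f := fun q : ι × ι =>
              (tupleCount W' (fun x => G.Adj (x q.1) (x q.2)) -
                pairDensity G W q.1 q.2 * boxVolume W') ^ 2 / boxVolume W)
              (fun q _ => hq' q) hpm
        _ ≤ _ := by
            rw [← Finset.sum_add_distrib]
            exact Finset.sum_le_sum fun q _ => hq q
    have h7 := mul_le_mul_of_nonneg_left h6 hc
    rw [mul_add] at h7
    linarith

open scoped Classical in
/-- A maximiser of the penalised energy is cut-regular. -/
theorem cutRegular_of_max {G : SimpleGraph V} {h : (ι → V) → Prop} {c ε : ℝ}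
    (hc : 0 < c) (hε : 0 ≤ ε) {W : ι → Finset V} (hW : ∀ i, (W i).Nonempty)
    (hmax : ∀ W' : ι → Finset V, (∀ i, W' i ⊆ W i) → (∀ i, (W' i).Nonempty) →
      energy G h c W' + c * ε ^ 2 / 4 * Real.log (boxVolume W') ≤
        energy G h c W + c * ε ^ 2 / 4 * Real.log (boxVolume W))
    {i j : ι} (hij : i ≠ j) : CutRegular G ε W i j := by
  intro U hU U' hU'
  have hV := boxVolume_pos hW
  have hα : 0 ≤ c * ε ^ 2 / 4 := by positivity
  set d := pairDensity G W i j with hd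
  set ℓ := energyExcess G h c W
  set S : (ι → Finset V) → ℝ := fun W' => ∑ x ∈ Fintype.piFinset W', ℓ x with hS
  have hji : ∀ A, Function.update W i A j = W j := fun A => Function.update_of_ne hij.symm _ _
  have hsub : ∀ A ⊆ W i, ∀ B ⊆ W j, ∀ l,
      Function.update (Function.update W i A) j B l ⊆ W l := fun A hA B hB l =>
    (update_subset (by rwa [hji]) l).trans (update_subset hA l)
  have hbound : ∀ A ⊆ W i, ∀ B ⊆ W j,
      S (Function.update (Function.update W i A) j B) +
        c * ((tupleCount (Function.update (Function.update W i A) j B)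
          (fun x => G.Adj (x i) (x j)) -
          d * boxVolume (Function.update (Function.update W i A) j B)) ^ 2 / boxVolume W) ≤
        c * ε ^ 2 / 4 * boxVolume W := fun A hA B hB =>
    excess_add_defect_le hc.le hα hW (hsub A hA B hB) (hmax _ (hsub A hA B hB)) (i, j) hij
  have hbound' : ∀ A ⊆ W i, ∀ B ⊆ W j,
      S (Function.update (Function.update W i A) j B) ≤ c * ε ^ 2 / 4 * boxVolume W := by
    intro A hA B hB
    refine le_trans (le_add_of_nonneg_right ?_) (hbound A hA B hB)
    positivity
  have s0 : S (Function.update W i U) + S (Function.update W i (W i \ U)) = 0 :=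
    (sum_piFinset_split W i hU ℓ).trans (sum_energyExcess_self G h c hW)
  have s1 := sum_piFinset_split (Function.update W i U) j (U := U') (by rwa [hji]) ℓ
  have s2 := sum_piFinset_split (Function.update W i (W i \ U)) j (U := U') (by rwa [hji]) ℓ
  rw [hji] at s1 s2
  have b1 := hbound U hU U' hU'
  have b2 := hbound' U hU (W j \ U') Finset.sdiff_subset
  have b3 := hbound' (W i \ U) Finset.sdiff_subset U' hU'
  have b4 := hbound' (W i \ U) Finset.sdiff_subset (W j \ U') Finset.sdiff_subset
  set W₁ := Function.update (Function.update W i U) j U'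
  set D := tupleCount W₁ (fun x => G.Adj (x i) (x j)) - d * boxVolume W₁ with hD
  -- The excesses of the four boxes cut out by `U` and `U'` sum to zero, so adding the four bounds
  -- leaves only the defect. This is why the penalty carries the factor 1/4.
  have h1 : c * (D ^ 2 / boxVolume W) ≤ c * (ε ^ 2 * boxVolume W) := by
    simp only [hS] at s0 b1 b2 b3 b4
    linarith
  have h2 : D ^ 2 ≤ (ε * boxVolume W) ^ 2 := by
    have := le_of_mul_le_mul_left h1 hc
    rw [div_le_iff₀ hV] at this
    calc _ ≤ _ := this
      _ = _ := by ring
  have h3 : |D| ≤ ε * boxVolume W := abs_le_of_sq_le_sq h2 (by positivity)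
  have h4 := sum_piFinset_update_update W hij U U'
    (fun x => (if G.Adj (x i) (x j) then (1 : ℝ) else 0) - d)
  have h5 : ∑ x ∈ Fintype.piFinset W₁, ((if G.Adj (x i) (x j) then (1 : ℝ) else 0) - d) = D := by
    rw [hD, Finset.sum_sub_distrib, tupleCount, boxVolume_eq_card]
    simp [mul_comm]
  rw [h5] at h4
  simp only [Function.update_self, Function.update_of_ne hij, Finset.sum_const, nsmul_eq_mul,
    ← boxVolume_eq_card] at h4
  refine le_of_mul_le_mul_left ?_ hV
  rw [← abs_of_pos hV, ← abs_mul, h4, abs_mul, abs_of_pos hV,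
    abs_of_nonneg (by positivity : (0 : ℝ) ≤ (W i).card * (W j).card)]
  calc _ ≤ ((W i).card * (W j).card : ℝ) * (ε * boxVolume W) := by gcongr
    _ = _ := by ring

end Regularity

/-! ### Disjoint parts from an average colouring -/

section Partition

/-- The tuple `x` lists the vertices of a clique. -/
def IsCliqueTuple {ι V : Type*} (G : SimpleGraph V) (x : ι → V) : Prop :=
  Pairwise fun i j => G.Adj (x i) (x j)

theorem IsCliqueTuple.injective {ι V : Type*} {G : SimpleGraph V} {x : ι → V}
    (hx : IsCliqueTuple G x) : Function.Injective x := by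
  intro i j hij
  by_contra h
  exact (hx h).ne hij

theorem isNClique_image_of_isCliqueTuple {n : ℕ} {V : Type*} [DecidableEq V]
    {G : SimpleGraph V} {x : Fin n → V} (hx : IsCliqueTuple G x) :
    G.IsNClique n (Finset.univ.image x) := by
  rw [SimpleGraph.isNClique_iff]
  refine ⟨?_, by rw [Finset.card_image_of_injective _ hx.injective]; simp⟩
  intro u hu v hv huv
  simp only [Finset.coe_image, Finset.coe_univ, Set.image_univ, Set.mem_range] at hu hv
  obtain ⟨i, rfl⟩ := hu
  obtain ⟨j, rfl⟩ := hv
  exact hx fun h => huv (by rw [h])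

open scoped Classical in
/-- Every clique is listed by `n!` tuples. -/
theorem factorial_mul_card_cliqueFinset_le {V : Type*} [Fintype V] (G : SimpleGraph V) (n : ℕ) :
    n.factorial * (G.cliqueFinset n).card ≤
      (Finset.univ.filter fun x : Fin n → V => IsCliqueTuple G x).card := by
  have he : ∀ s : {s // s ∈ G.cliqueFinset n}, Nonempty (Fin n ≃ s.1) := fun s =>
    ⟨(Finset.equivFinOfCardEq ((SimpleGraph.mem_cliqueFinset_iff.1 s.2).card_eq)).symm⟩
  let e := fun s => (he s).some
  have hcard : n.factorial * (G.cliqueFinset n).card =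
      Fintype.card ({s // s ∈ G.cliqueFinset n} × Equiv.Perm (Fin n)) := by
    rw [Fintype.card_prod, Fintype.card_perm, Fintype.card_fin, Fintype.card_coe, mul_comm]
  rw [hcard, ← Finset.card_univ]
  refine Finset.card_le_card_of_injOn
    (fun q => fun i => ((e q.1 (q.2 i) : q.1.1) : V)) ?_ ?_
  · rintro ⟨s, σ⟩ _
    simp only [Finset.coe_filter, Finset.mem_univ, true_and, Set.mem_ofPred_eq]
    intro i j hij
    refine (SimpleGraph.mem_cliqueFinset_iff.1 s.2).isClique (Finset.mem_coe.2 (Subtype.coe_prop _))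
      (Finset.mem_coe.2 (Subtype.coe_prop _)) fun h => hij ?_
    exact σ.injective ((e s).injective (Subtype.ext h))
  · rintro ⟨s, σ⟩ _ ⟨t, ρ⟩ _ h
    have himg : ∀ (s : {s // s ∈ G.cliqueFinset n}) (σ : Equiv.Perm (Fin n)),
        Finset.univ.image (fun i => ((e s (σ i) : s.1) : V)) = s.1 := by
      intro s σ
      ext v
      simp only [Finset.mem_image, Finset.mem_univ, true_and]
      constructor
      · rintro ⟨i, rfl⟩; exact Subtype.coe_prop _
      · intro hv
        exact ⟨σ.symm ((e s).symm ⟨v, hv⟩), by simp⟩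
    have hst : s = t := by
      apply Subtype.ext
      rw [← himg s σ, ← himg t ρ]
      exact congrArg (fun f => Finset.univ.image f) h
    subst hst
    congr 1
    ext1 i
    exact (e s).injective (Subtype.ext (congrFun h i))

open scoped Classical in
/-- The number of left inverses of an injective tuple. -/
theorem pow_mul_card_leftInverse {V : Type*} [Fintype V] {n : ℕ} {x : Fin n → V}
    (hx : Function.Injective x) :
    n ^ n * (Finset.univ.filter fun φ : V → Fin n => ∀ i, φ (x i) = i).card =
      n ^ Fintype.card V := by
  -- The values of `φ` are forced at the `n` entries of `x` and free elsewhere.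
  have h1 : (Finset.univ.filter fun φ : V → Fin n => ∀ i, φ (x i) = i) =
      Fintype.piFinset fun v => Finset.univ.filter fun a => ∀ i, x i = v → a = i := by
    ext φ
    simp only [Finset.mem_filter, Finset.mem_univ, true_and, Fintype.mem_piFinset]
    exact ⟨fun h v i hv => hv ▸ h i, fun h i => h _ i rfl⟩
  have h2 : ∀ v, (Finset.univ.filter fun a => ∀ i, x i = v → a = i).card =
      if v ∈ Finset.univ.image x then 1 else n := by
    intro v
    split_ifs with hv
    · obtain ⟨j, -, rfl⟩ := Finset.mem_image.1 hv
      rw [Finset.card_eq_one]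
      refine ⟨j, ?_⟩
      ext a
      simp only [Finset.mem_filter, Finset.mem_univ, true_and, Finset.mem_singleton]
      exact ⟨fun h => h j rfl, fun h i hi => h.trans (hx hi).symm⟩
    · have : (Finset.univ.filter fun a => ∀ i, x i = v → a = i) = Finset.univ := by
        refine Finset.filter_true_of_mem fun a _ i hi => ?_
        exact absurd (Finset.mem_image.2 ⟨i, Finset.mem_univ _, hi⟩) hv
      rw [this]; simp
  have h3 : (Finset.univ.filter fun v => v ∈ Finset.univ.image x).card = n := by
    rw [Finset.filter_mem_eq_inter, Finset.univ_inter, Finset.card_image_of_injective _ hx]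
    simp
  have h4 := Finset.card_filter_add_card_filter_not (s := (Finset.univ : Finset V))
    (fun v => v ∈ Finset.univ.image x)
  rw [h3, Finset.card_univ] at h4
  rw [h1, Fintype.card_piFinset]
  simp only [h2]
  rw [Finset.prod_ite, Finset.prod_const_one, one_mul, Finset.prod_const, ← pow_add, h4]

/-- The inequality of arithmetic and geometric means for natural numbers. -/
theorem prod_mul_card_pow_le {n : ℕ} (f : Fin n → ℝ) (hf : ∀ i, 0 ≤ f i) :
    (∏ i, f i) * (n : ℝ) ^ n ≤ (∑ i, f i) ^ n := by
  rcases Nat.eq_zero_or_pos n with rfl | hn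
  · simp
  have hn' : (0 : ℝ) < n := by exact_mod_cast hn
  have h := Real.geom_mean_le_arith_mean Finset.univ (fun _ => (1 : ℝ)) f
    (fun _ _ => zero_le_one) (by simp [hn']) (fun i _ => hf i)
  simp only [Real.rpow_one, Finset.sum_const, Finset.card_univ, Fintype.card_fin, nsmul_eq_mul,
    mul_one, one_mul] at h
  have hp : 0 ≤ ∏ i, f i := Finset.prod_nonneg fun i _ => hf i
  have h2 := pow_le_pow_left₀ (Real.rpow_nonneg hp _) h n
  rw [Real.rpow_inv_natCast_pow hp hn.ne', div_pow, le_div_iff₀ (by positivity)] at h2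
  exact h2

open scoped Classical in
/-- Disjoint parts that carry at least the average number of transversal cliques. -/
theorem exists_disjoint_parts {V : Type*} [Fintype V] [Nonempty V] (G : SimpleGraph V) {n : ℕ}
    (hn : 0 < n) :
    ∃ W : Fin n → Finset V, (∀ i j, i ≠ j → Disjoint (W i) (W j)) ∧
      (n.factorial * (G.cliqueFinset n).card : ℝ) ≤ tupleCount W (IsCliqueTuple G) * (n : ℝ) ^ n ∧
      boxVolume W * (n : ℝ) ^ n ≤ (Fintype.card V : ℝ) ^ n := by
  have : Nonempty (Fin n) := ⟨⟨0, hn⟩⟩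
  set X := Finset.univ.filter fun x : Fin n → V => IsCliqueTuple G x
  set R : (V → Fin n) → (Fin n → V) → Prop := fun φ x => ∀ i, φ (x i) = i
  have h1 : ∀ φ : V → Fin n,
      tupleCount (fun i => Finset.univ.filter fun v => φ v = i) (IsCliqueTuple G) =
        ((X.filter fun x => R φ x).card : ℝ) := by
    intro φ
    rw [tupleCount, Finset.sum_boole]
    congr 2
    ext x
    simp [X, R, Fintype.mem_piFinset, and_comm]
  -- Double counting: every clique tuple is coloured correctly by a fraction `n ^ (-n)` of all
  -- colourings, so some colouring reaches the average.
  have h2 : ∑ φ : V → Fin n, n ^ n * (X.filter fun x => R φ x).card =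
      ∑ _φ : V → Fin n, X.card := by
    have hsw : ∑ φ : V → Fin n, (X.filter fun x => R φ x).card =
        ∑ x ∈ X, (Finset.univ.filter fun φ : V → Fin n => R φ x).card := by
      exact Finset.sum_card_bipartiteAbove_eq_sum_card_bipartiteBelow R
    rw [← Finset.mul_sum, hsw, Finset.mul_sum]
    have : ∀ x ∈ X, n ^ n * (Finset.univ.filter fun φ : V → Fin n => R φ x).card =
        n ^ Fintype.card V := fun x hx =>
      pow_mul_card_leftInverse (Finset.mem_filter.1 hx).2.injective
    rw [Finset.sum_congr rfl this]
    simp [mul_comm]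
  obtain ⟨φ, -, hφ⟩ := Finset.exists_le_of_sum_le Finset.univ_nonempty h2.ge
  refine ⟨fun i => Finset.univ.filter fun v => φ v = i, ?_, ?_, ?_⟩
  · intro i j hij
    rw [Finset.disjoint_filter]
    rintro v - rfl
    exact hij
  · rw [h1, mul_comm _ ((n : ℝ) ^ n)]
    exact_mod_cast (factorial_mul_card_cliqueFinset_le G n).trans hφ
  · refine (prod_mul_card_pow_le _ fun _ => Nat.cast_nonneg _).trans_eq ?_
    rw [← Nat.cast_sum, ← Finset.card_eq_sum_card_fiberwise (f := φ) (s := Finset.univ)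
      (t := Finset.univ) (fun _ _ => Finset.mem_coe.2 (Finset.mem_univ _)), Finset.card_univ]

end Partition

/-! ### Extensions of cliques and star densities -/

section Star

open scoped Classical in
theorem sum_piFinset_insertNth {k : ℕ} {V : Type*} (W : Fin (k + 1) → Finset V) (c : Fin (k + 1))
    (F : (Fin (k + 1) → V) → ℝ) :
    ∑ x ∈ Fintype.piFinset W, F x =
      ∑ e ∈ Fintype.piFinset (fun i => W (c.succAbove i)), ∑ a ∈ W c,
        F (c.insertNth (α := fun _ => V) a e) := by
  rw [← Finset.sum_product']
  refine (Finset.sum_nbij' (fun q => c.insertNth (α := fun _ => V) q.2 q.1)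
    (fun x => (fun i => x (c.succAbove i), x c)) ?_ ?_ ?_ ?_ ?_).symm
  · rintro ⟨e, a⟩ h
    simp only [Finset.mem_product, Fintype.mem_piFinset] at h ⊢
    intro j
    rcases Fin.eq_self_or_eq_succAbove c j with rfl | ⟨i, rfl⟩
    · simpa using h.2
    · simpa using h.1 i
  · intro x h
    simp only [Finset.mem_product, Fintype.mem_piFinset] at h ⊢
    exact ⟨fun i => h _, h c⟩
  · rintro ⟨e, a⟩ _; simp
  · intro x _
    exact Fin.insertNth_self_removeNth c x
  · rintro ⟨e, a⟩ _; rfl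

theorem isCliqueTuple_insertNth {k : ℕ} {V : Type*} {G : SimpleGraph V} (c : Fin (k + 1))
    (a : V) (e : Fin k → V) :
    IsCliqueTuple G (c.insertNth (α := fun _ => V) a e) ↔
      IsCliqueTuple G e ∧ ∀ i, G.Adj a (e i) := by
  constructor
  · intro h
    refine ⟨fun i j hij => ?_, fun i => ?_⟩
    · simpa using h (i := c.succAbove i) (j := c.succAbove j) (by simpa using hij)
    · simpa using h (i := c) (j := c.succAbove i) (Fin.succAbove_ne c i).symm
  · rintro ⟨h1, h2⟩ i j hij
    rcases Fin.eq_self_or_eq_succAbove c i with rfl | ⟨i, rfl⟩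
    · rcases Fin.eq_self_or_eq_succAbove i j with rfl | ⟨j, rfl⟩
      · exact absurd rfl hij
      · simpa using h2 j
    · rcases Fin.eq_self_or_eq_succAbove c j with rfl | ⟨j, rfl⟩
      · simpa using (h2 i).symm
      · simpa using h1 (fun h : i = j => hij (by rw [h]))

open scoped Classical in
/-- The number of vertices of `C` adjacent to every vertex of `e`. -/
noncomputable def extCount {k : ℕ} {V : Type*} (G : SimpleGraph V) (C : Finset V)
    (e : Fin k → V) : ℝ :=
  ((C.filter fun a => ∀ i, G.Adj a (e i)).card : ℝ)

/-- The product of the densities of the pairs at `c`. -/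
noncomputable def starDensity {k : ℕ} {V : Type*} (G : SimpleGraph V)
    (W : Fin (k + 1) → Finset V) (c : Fin (k + 1)) : ℝ :=
  ∏ j, pairDensity G W c (c.succAbove j)

variable {k : ℕ} {V : Type*} {G : SimpleGraph V} {ε : ℝ} {W : Fin (k + 1) → Finset V}

open scoped Classical in
/-- Counting extensions of an arbitrary set `S` of tuples. -/
theorem abs_sum_extCount_sub_le (hW : ∀ i, (W i).Nonempty)
    (hreg : ∀ i j, i ≠ j → CutRegular G ε W i j) (c : Fin (k + 1)) (S : (Fin k → V) → Prop)
    [DecidablePred S] :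
    |∑ e ∈ (Fintype.piFinset fun i => W (c.succAbove i)).filter S, extCount G (W c) e -
      starDensity G W c * ((W c).card *
        ((Fintype.piFinset fun i => W (c.succAbove i)).filter S).card)| ≤
      k * (ε * boxVolume W) := by
  set P : Finset (Fin (k + 1) × Fin (k + 1)) :=
    Finset.univ.image fun j => (c, c.succAbove j) with hP
  have hinj : Function.Injective fun j : Fin k => (c, c.succAbove j) := fun i j h => by
    simpa using h
  have hne : ∀ p ∈ P, p.1 ≠ p.2 := by
    intro p hp
    obtain ⟨j, -, rfl⟩ := Finset.mem_image.1 hp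
    exact (Fin.succAbove_ne c j).symm
  have h1 := abs_tupleCount_sub_le (G := G) (ε := ε) hW
    (h := fun x => S fun i => x (c.succAbove i)) P hne ?_ (fun p hp => hreg _ _ (hne p hp)) ?_
  · have e1 : tupleCount W (fun x => (S fun i => x (c.succAbove i)) ∧
        ∀ p ∈ P, G.Adj (x p.1) (x p.2)) =
        ∑ e ∈ (Fintype.piFinset fun i => W (c.succAbove i)).filter S, extCount G (W c) e := by
      rw [tupleCount, sum_piFinset_insertNth W c, Finset.sum_filter]
      refine Finset.sum_congr rfl fun e _ => ?_
      by_cases he : S e <;> simp [hP, he, extCount, Finset.sum_boole]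
    have e2 : tupleCount W (fun x => S fun i => x (c.succAbove i)) =
        (W c).card * ((Fintype.piFinset fun i => W (c.succAbove i)).filter S).card := by
      rw [tupleCount, sum_piFinset_insertNth W c, Finset.card_filter]
      push_cast
      rw [Finset.mul_sum]
      refine Finset.sum_congr rfl fun e _ => ?_
      by_cases he : S e <;> simp [he]
    have e3 : ∏ p ∈ P, pairDensity G W p.1 p.2 = starDensity G W c := by
      rw [hP, Finset.prod_image hinj.injOn]; rfl
    have e4 : P.card = k := by
      rw [hP, Finset.card_image_of_injective _ hinj]; simp
    rw [e1, e2, e3, e4] at h1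
    exact h1
  · intro p hp q hq hpq
    obtain ⟨i, -, rfl⟩ := Finset.mem_image.1 hp
    obtain ⟨j, -, rfl⟩ := Finset.mem_image.1 hq
    exact fun h => hpq (Prod.ext rfl (Sym2.congr_right.1 h))
  · intro p hp x
    obtain ⟨j, -, rfl⟩ := Finset.mem_image.1 hp
    -- `S` ignores coordinate `c`, so it factors over every pair at `c`, however wild it is.
    refine ⟨fun _ => True, fun b => S fun i => Function.update x (c.succAbove j) b
      (c.succAbove i), fun a b => ?_⟩
    simp only [true_and]
    rw [Function.update_comm (Fin.succAbove_ne c j).symm]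
    simp

open scoped Classical in
theorem tupleCount_isCliqueTuple (c : Fin (k + 1)) :
    tupleCount W (IsCliqueTuple G) =
      ∑ e ∈ (Fintype.piFinset fun i => W (c.succAbove i)).filter (IsCliqueTuple G),
        extCount G (W c) e := by
  rw [tupleCount, sum_piFinset_insertNth W c, Finset.sum_filter]
  refine Finset.sum_congr rfl fun e _ => ?_
  by_cases he : IsCliqueTuple G e <;>
    simp [isCliqueTuple_insertNth, he, extCount, Finset.sum_boole]

open scoped Classical in
/-- The mixed graph whose tuples are the cliques with at least `τ |C|` extensions. -/
noncomputable def cliqueMixedGraph (G : SimpleGraph V) (W : Fin (k + 1) → Finset V)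
    (hdisj : ∀ i j, i ≠ j → Disjoint (W i) (W j)) (c : Fin (k + 1)) (τ : ℝ) :
    MixedGraph k V where
  A i := W (c.succAbove i)
  C := W c
  disjoint_A i j hij := hdisj _ _ (by simpa using hij)
  disjoint_C i := hdisj _ _ (Fin.succAbove_ne c i)
  edges := (Fintype.piFinset fun i => W (c.succAbove i)).filter fun e =>
    IsCliqueTuple G e ∧ τ * (W c).card ≤ extCount G (W c) e
  mem_of_edge e he := Fintype.mem_piFinset.1 (Finset.mem_filter.1 he).1
  graph :=
    { Adj := fun u v => G.Adj u v ∧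
        ((u ∈ W c ∧ ∃ i, v ∈ W (c.succAbove i)) ∨ (v ∈ W c ∧ ∃ i, u ∈ W (c.succAbove i)))
      symm := ⟨fun _ _ h => ⟨h.1.symm, h.2.symm⟩⟩
      loopless := ⟨fun _ h => h.1.ne rfl⟩ }
  bipartite _ _ h := h.2

theorem isCliqueTuple_of_mem_edges {hdisj : ∀ i j, i ≠ j → Disjoint (W i) (W j)}
    {c : Fin (k + 1)} {τ : ℝ} {e : Fin k → V}
    (he : e ∈ (cliqueMixedGraph G W hdisj c τ).edges) : IsCliqueTuple G e := by
  classical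
  exact (Finset.mem_filter.1 he).2.1

theorem le_minExtDensity_cliqueMixedGraph (hdisj : ∀ i j, i ≠ j → Disjoint (W i) (W j))
    (c : Fin (k + 1)) (hc : (W c).Nonempty) (τ : ℝ)
    (hne : (cliqueMixedGraph G W hdisj c τ).edges.Nonempty) :
    τ ≤ (cliqueMixedGraph G W hdisj c τ).minExtDensity := by
  classical
  rw [MixedGraph.minExtDensity, dif_pos hne, Finset.le_inf'_iff]
  intro e he
  have hcard : (0 : ℝ) < (W c).card := by exact_mod_cast hc.card_pos
  obtain ⟨h1, -, h3⟩ := Finset.mem_filter.1 he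
  refine (le_div_iff₀ hcard).2 ?_
  refine h3.trans (le_of_eq ?_)
  rw [extCount, MixedGraph.extensions]
  congr 2
  ext a
  rw [Finset.mem_filter]
  refine Iff.trans ?_ Finset.mem_filter.symm
  refine and_congr_right fun ha => forall_congr' fun i => ?_
  exact ⟨fun h => ⟨h, Or.inl ⟨ha, i, Fintype.mem_piFinset.1 h1 i⟩⟩, fun h => h.1⟩

/-- The clique tuples with at least half the expected number of extensions are dense. -/
theorem le_density_cliqueMixedGraph (hdisj : ∀ i j, i ≠ j → Disjoint (W i) (W j))
    (hW : ∀ i, (W i).Nonempty) (hreg : ∀ i j, i ≠ j → CutRegular G ε W i j) (c : Fin (k + 1)) :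
    tupleCount W (IsCliqueTuple G) / boxVolume W - 3 * (k * ε) ≤
      (cliqueMixedGraph G W hdisj c (starDensity G W c / 2)).density * starDensity G W c := by
  classical
  set p := starDensity G W c
  set A := Fintype.piFinset fun i => W (c.succAbove i) with hA
  set K := A.filter (IsCliqueTuple G)
  set B := A.filter fun e => IsCliqueTuple G e ∧ ¬ p / 2 * (W c).card ≤ extCount G (W c) e with hB
  set E := (cliqueMixedGraph G W hdisj c (p / 2)).edges with hE
  have hvol : boxVolume W = (W c).card * ∏ i, ((W (c.succAbove i)).card : ℝ) :=
    Fin.prod_univ_succAbove _ c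
  have hpos := boxVolume_pos hW
  have hcard : (E.card : ℝ) + B.card = K.card := by
    have : E = K.filter fun e => p / 2 * (W c).card ≤ extCount G (W c) e := by
      rw [Finset.filter_filter]; rfl
    have h' : B = K.filter fun e => ¬ p / 2 * (W c).card ≤ extCount G (W c) e := by
      rw [Finset.filter_filter]
    rw [this, h']
    exact_mod_cast Finset.card_filter_add_card_filter_not (s := K) _
  have h1 := abs_sum_extCount_sub_le hW hreg c (IsCliqueTuple G)
  have h2 := abs_sum_extCount_sub_le hW hreg c
    (fun e => IsCliqueTuple G e ∧ ¬ p / 2 * (W c).card ≤ extCount G (W c) e)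
  rw [← tupleCount_isCliqueTuple] at h1
  have h3 : ∑ e ∈ B, extCount G (W c) e ≤ B.card * (p / 2 * (W c).card) := by
    rw [← nsmul_eq_mul]
    exact Finset.sum_le_card_nsmul _ _ _ fun e he =>
      (not_le.1 (Finset.mem_filter.1 he).2.2).le
  have h4 : _ - p * ((W c).card * K.card) ≤ _ := (abs_le.1 h1).2
  have h5 : _ ≤ ∑ e ∈ B, extCount G (W c) e - p * ((W c).card * B.card) := (abs_le.1 h2).1
  -- One error comes from counting over all cliques. The other two come from `B`: `h3` and `h5` give
  -- `p * |W c| * |B| / 2 ≤ k * ε * boxVolume W`.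
  have h6 : tupleCount W (IsCliqueTuple G) - 3 * (k * ε) * boxVolume W ≤
      E.card * p * (W c).card := by
    have : (E.card : ℝ) = K.card - B.card := by linarith
    rw [this]
    linarith
  have hcpos : (0 : ℝ) < (W c).card := by exact_mod_cast (hW c).card_pos
  have hApos : (0 : ℝ) < ∏ i, ((W (c.succAbove i)).card : ℝ) :=
    Finset.prod_pos fun i _ => by exact_mod_cast (hW _).card_pos
  have h7 : (cliqueMixedGraph G W hdisj c (p / 2)).density * p =
      E.card * p * (W c).card / boxVolume W := by
    rw [hvol]
    change (E.card : ℝ) / (∏ i, ((W (c.succAbove i)).card : ℝ)) * p = _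
    field_simp
  rw [h7, le_div_iff₀ hpos, sub_mul, div_mul_cancel₀ _ hpos.ne']
  exact h6

/-- The pairs `i < j`. -/
def ltPairs (n : ℕ) : Finset (Fin n × Fin n) :=
  Finset.univ.filter fun p => p.1 < p.2

/-- Each pair {i, j} is counted in the star at `i` and again in the star at `j`. -/
theorem prod_starDensity (G : SimpleGraph V) (W : Fin (k + 1) → Finset V) :
    ∏ c, starDensity G W c = (∏ p ∈ ltPairs (k + 1), pairDensity G W p.1 p.2) ^ 2 := by
  have h1 : ∀ c, starDensity G W c = ∏ j, if c = j then 1 else pairDensity G W c j := by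
    intro c
    rw [Fin.prod_univ_succAbove _ c, if_pos rfl, one_mul]
    exact Finset.prod_congr rfl fun j _ => (if_neg (Fin.succAbove_ne c j).symm).symm
  simp only [h1]
  rw [← Finset.prod_product', sq]
  have h2 : ∀ p : Fin (k + 1) × Fin (k + 1),
      (if p.1 = p.2 then 1 else pairDensity G W p.1 p.2) =
        (if p.1 < p.2 then pairDensity G W p.1 p.2 else 1) *
          (if p.2 < p.1 then pairDensity G W p.2 p.1 else 1) := by
    intro p
    rcases lt_trichotomy p.1 p.2 with h | h | h
    · simp [h, h.ne, h.le]
    · simp [h]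
    · simp [h, h.ne', h.le, pairDensity_comm G W p.1 p.2]
  simp only [h2, Finset.univ_product_univ, Finset.prod_mul_distrib]
  congr 1
  · rw [ltPairs, Finset.prod_filter]
  · rw [ltPairs, Finset.prod_filter]
    exact Fintype.prod_equiv (Equiv.prodComm _ _) _ _ fun p => rfl

theorem isCliqueTuple_iff_ltPairs {n : ℕ} (x : Fin n → V) :
    IsCliqueTuple G x ↔ ∀ p ∈ ltPairs n, G.Adj (x p.1) (x p.2) := by
  constructor
  · intro h p hp
    exact h (Finset.mem_filter.1 hp).2.ne
  · intro h i j hij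
    rcases hij.lt_or_gt with hlt | hlt
    · exact h (i, j) (by simp [ltPairs, hlt])
    · exact (h (j, i) (by simp [ltPairs, hlt])).symm

/-- The clique density of a cut-regular tuple is at most the product of its pair densities, up to
an error. -/
theorem tupleCount_isCliqueTuple_le {n : ℕ} {W : Fin n → Finset V} (hε : 0 ≤ ε)
    (hW : ∀ i, (W i).Nonempty) (hreg : ∀ i j, i ≠ j → CutRegular G ε W i j) :
    tupleCount W (IsCliqueTuple G) / boxVolume W ≤
      ∏ p ∈ ltPairs n, pairDensity G W p.1 p.2 + (n : ℝ) ^ 2 * ε := by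
  have hlt : ∀ p ∈ ltPairs n, p.1 < p.2 := fun p hp => (Finset.mem_filter.1 hp).2
  have h1 := abs_tupleCount_sub_le (G := G) (ε := ε) hW (h := fun _ => True) (ltPairs n)
    (fun p hp => (hlt p hp).ne) ?_ (fun p hp => hreg _ _ (hlt p hp).ne)
    (fun p _ => factorsOver_true _ _)
  · have h2 : IsCliqueTuple G = fun x : Fin n → V =>
        True ∧ ∀ p ∈ ltPairs n, G.Adj (x p.1) (x p.2) := by
      funext x
      rw [true_and, eq_iff_iff, isCliqueTuple_iff_ltPairs]
    rw [← h2] at h1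
    have h3 : tupleCount W (fun _ => True) = boxVolume W := by
      simp [tupleCount, boxVolume_eq_card]
    have hcard : ((ltPairs n).card : ℝ) ≤ (n : ℝ) ^ 2 := by
      have : (ltPairs n).card ≤ Fintype.card (Fin n × Fin n) := Finset.card_le_univ _
      rw [Fintype.card_prod, Fintype.card_fin] at this
      rw [sq]; exact_mod_cast this
    rw [h3] at h1
    have hpos := boxVolume_pos hW
    rw [div_le_iff₀ hpos]
    have h4 := (abs_le.1 h1).2
    have h5 : ((ltPairs n).card : ℝ) * (ε * boxVolume W) ≤ (n : ℝ) ^ 2 * (ε * boxVolume W) :=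
      mul_le_mul_of_nonneg_right hcard (by positivity)
    linarith
  · intro p hp q hq hpq h
    rcases Sym2.eq_iff.1 h with h | h
    · exact hpq (Prod.ext h.1 h.2)
    · have a := hlt p hp
      have b := hlt q hq
      rw [h.1, h.2] at a
      exact absurd a b.le.not_gt

end Star

/-! ### Numerical estimates -/

theorem four_mul_two_pow_le_sq_factorial {n : ℕ} (hn : 3 ≤ n) :
    4 * 2 ^ n ≤ n.factorial ^ 2 := by
  induction n, hn using Nat.le_induction with
  | base => decide
  | succ n hn ih =>
    rw [Nat.factorial_succ, mul_pow, pow_succ]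
    nlinarith [Nat.pow_le_pow_left (show 2 ≤ n + 1 by omega) 2]

theorem six_le_factorial {n : ℕ} (hn : 3 ≤ n) : 6 ≤ n.factorial :=
  Nat.factorial_le hn

/-- The size of the parts of the regular tuple is more than what is asked for. -/
theorem rpow_le_exp_mul {k : ℕ} (hk : 2 ≤ k) {γ : ℝ} (hγ : 0 < γ) (hγ' : γ ≤ 1 / 2) :
    γ ^ ((k : ℝ) ^ (50 : ℕ) * (γ ^ (10 : ℕ))⁻¹) * ((k + 1 : ℕ) : ℝ) ^ (k + 1) ≤
      Real.exp (-(32 * ((k + 1 : ℕ) : ℝ) ^ 6 / γ ^ 3)) * γ := by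
  have hk' : (2 : ℝ) ≤ k := by exact_mod_cast hk
  set n : ℝ := ((k + 1 : ℕ) : ℝ) with hn
  have hn0 : 0 < n := by rw [hn]; positivity
  have hnk : n ≤ 2 * k := by rw [hn]; push_cast; linarith
  set L := -Real.log γ with hL
  have hLhalf : 1 / 2 ≤ L := by
    have h1 : Real.log γ ≤ γ - 1 := Real.log_le_sub_one_of_pos hγ
    linarith
  have hinv : 1 ≤ γ⁻¹ := (one_le_inv₀ hγ).2 (by linarith)
  have hlogn : Real.log n ≤ n := (Real.log_le_sub_one_of_pos hn0).trans (by linarith)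
  rw [← Real.log_le_log_iff (by positivity) (by positivity),
    Real.log_mul (by positivity) (by positivity), Real.log_mul (by positivity) hγ.ne',
    Real.log_exp, Real.log_rpow hγ, Real.log_pow]
  have e1 : Real.log γ = -L := by rw [hL]; ring
  rw [e1, ← hn]
  set t := γ⁻¹ with ht
  have hdiv : 32 * n ^ 6 / γ ^ 3 = 32 * n ^ 6 * t ^ 3 := by rw [ht, inv_pow]; rfl
  rw [hdiv, ← inv_pow, ← ht]
  have hn6 : n ^ 6 ≤ 64 * (k : ℝ) ^ 6 := by
    calc n ^ 6 ≤ (2 * k) ^ 6 := by gcongr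
      _ = _ := by ring
  have hn2 : n * Real.log n ≤ 4 * (k : ℝ) ^ 2 := by
    calc n * Real.log n ≤ n * n := by gcongr
      _ ≤ (2 * k) * (2 * k) := by gcongr
      _ = _ := by ring
  have hk44 : (2 : ℝ) ^ 44 ≤ (k : ℝ) ^ 44 := by gcongr
  have hk6 : (k : ℝ) ^ 2 ≤ (k : ℝ) ^ 6 := pow_le_pow_right₀ (by linarith) (by norm_num)
  have h1k : 1 ≤ (k : ℝ) ^ 6 := one_le_pow₀ (by linarith)
  have ht3 : 1 ≤ t ^ 3 := one_le_pow₀ hinv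
  have ht10 : t ^ 3 ≤ t ^ 10 := pow_le_pow_right₀ hinv (by norm_num)
  have hX : 1 ≤ (k : ℝ) ^ 6 * t ^ 3 := one_le_mul_of_one_le_of_one_le h1k ht3
  have hk6t : (k : ℝ) ^ 6 ≤ (k : ℝ) ^ 6 * t ^ 3 := le_mul_of_one_le_right (by positivity) ht3
  -- After taking logarithms, every loss is a modest multiple of `k ^ 6 * t ^ 3` or of `L`; the 44
  -- spare powers of `k ≥ 2` absorb them.
  have h50 : (2 : ℝ) ^ 44 * ((k : ℝ) ^ 6 * t ^ 3) ≤ (k : ℝ) ^ 50 * t ^ 10 := by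
    calc (2 : ℝ) ^ 44 * ((k : ℝ) ^ 6 * t ^ 3) ≤ (k : ℝ) ^ 44 * ((k : ℝ) ^ 6 * t ^ 10) := by
          gcongr
      _ = _ := by ring
  set X := (k : ℝ) ^ 6 * t ^ 3 with hXdef
  have hA : 32 * n ^ 6 * t ^ 3 ≤ 2048 * X := by
    calc 32 * n ^ 6 * t ^ 3 ≤ 32 * (64 * (k : ℝ) ^ 6) * t ^ 3 := by gcongr
      _ = _ := by rw [hXdef]; ring
  have hB : (2 : ℝ) ^ 44 * X * L ≤ (k : ℝ) ^ 50 * t ^ 10 * L := by gcongr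
  have hC : X * (1 / 2) ≤ X * L := by gcongr
  have hD : 1 * L ≤ X * L := by gcongr
  have hn2' : ((k + 1 : ℕ) : ℝ) * Real.log n ≤ 4 * X := by
    rw [← hn]; linarith
  norm_num at hB
  nlinarith

/-- The factor n! from ordering cliques pays for halving `p` and `D`: `(p / 2) ^ n` is at least `n!
^ 2 * γ ^ 2 / (4 * 2 ^ n)`. -/
theorem two_mul_rpow_le {n : ℕ} (hn : 3 ≤ n) {γ D p : ℝ} (hγ : 0 < γ) (hp : 0 ≤ p)
    (hD : n.factorial * γ / 2 ≤ D) (hpD : D ^ 2 ≤ p ^ n) :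
    γ ^ ((2 : ℝ) / n) ≤ p / 2 := by
  have hn0 : n ≠ 0 := by omega
  have h1 : (γ : ℝ) ^ 2 ≤ (p / 2) ^ n := by
    have hf : (4 : ℝ) * 2 ^ n ≤ (n.factorial : ℝ) ^ 2 := by
      exact_mod_cast four_mul_two_pow_le_sq_factorial hn
    rw [div_pow, le_div_iff₀ (by positivity)]
    have h2 : (n.factorial * γ / 2) ^ 2 ≤ D ^ 2 := by gcongr
    have h3 : γ ^ 2 * 2 ^ n ≤ (n.factorial * γ / 2) ^ 2 := by
      calc γ ^ 2 * 2 ^ n = γ ^ 2 / 4 * (4 * 2 ^ n) := by ring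
        _ ≤ γ ^ 2 / 4 * (n.factorial : ℝ) ^ 2 := by gcongr
        _ = _ := by ring
    linarith
  rw [div_eq_mul_inv, Real.rpow_mul hγ.le, Real.rpow_two]
  calc (γ ^ 2) ^ ((n : ℝ)⁻¹) ≤ ((p / 2) ^ n) ^ ((n : ℝ)⁻¹) := by gcongr
    _ = p / 2 := Real.pow_rpow_inv_natCast (by positivity) hn0

theorem starDensity_nonneg {k : ℕ} {V : Type*} (G : SimpleGraph V)
    (W : Fin (k + 1) → Finset V) (c : Fin (k + 1)) : 0 ≤ starDensity G W c :=
  Finset.prod_nonneg fun _ _ => pairDensity_nonneg _ _ _ _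

theorem starDensity_le_one {k : ℕ} {V : Type*} (G : SimpleGraph V)
    (W : Fin (k + 1) → Finset V) (c : Fin (k + 1)) : starDensity G W c ≤ 1 :=
  Finset.prod_le_one (fun _ _ => pairDensity_nonneg _ _ _ _)
    fun _ _ => pairDensity_le_one _ _ _ _

/-! ### Assembling the proof -/

open scoped Classical in
/-- Large disjoint cut-regular parts with many transversal cliques. -/
theorem exists_cutRegular_parts {V : Type*} [Fintype V] [Nonempty V] (G : SimpleGraph V)
    {n : ℕ} (hn : 0 < n) {γ : ℝ} (hγ : 0 < γ) (hγ' : γ ≤ 1 / 2)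
    (hG : γ * (Fintype.card V : ℝ) ^ n ≤ ((G.cliqueFinset n).card : ℝ)) :
    ∃ W : Fin n → Finset V, (∀ i j, i ≠ j → Disjoint (W i) (W j)) ∧ (∀ i, (W i).Nonempty) ∧
      (∀ i j, i ≠ j → CutRegular G (γ / (2 * (n : ℝ) ^ 2)) W i j) ∧
      n.factorial * γ - γ ≤ tupleCount W (IsCliqueTuple G) / boxVolume W ∧
      Real.exp (-(32 * (n : ℝ) ^ 6 / γ ^ 3)) * γ * (Fintype.card V : ℝ) ^ n ≤
        boxVolume W * (n : ℝ) ^ n := by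
  obtain ⟨W₀, hdisj, hT, hvol⟩ := exists_disjoint_parts G hn
  have hn' : (0 : ℝ) < n := by exact_mod_cast hn
  have hN : (0 : ℝ) < Fintype.card V := by exact_mod_cast Fintype.card_pos
  have hf : (1 : ℝ) ≤ n.factorial := by exact_mod_cast n.factorial_pos
  have hT' : n.factorial * γ * (Fintype.card V : ℝ) ^ n ≤
      tupleCount W₀ (IsCliqueTuple G) * (n : ℝ) ^ n := by
    refine le_trans ?_ hT
    rw [mul_assoc]
    gcongr
  have hT0 : 0 < tupleCount W₀ (IsCliqueTuple G) :=
    pos_of_mul_pos_left (lt_of_lt_of_le (by positivity) hT') (by positivity)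
  have hv0 : 0 < boxVolume W₀ := hT0.trans_le (tupleCount_le _ _)
  have hne₀ := nonempty_of_boxVolume_ne_zero hv0.ne'
  -- With these values the pair densities add at most γ to the energy, and the clique counting error
  -- `n ^ 2 * ε` is γ/2.
  set c : ℝ := γ / (n : ℝ) ^ 2 with hc
  set ε : ℝ := γ / (2 * (n : ℝ) ^ 2) with hε
  have hc0 : 0 < c := by positivity
  have hε0 : 0 < ε := by positivity
  obtain ⟨W, hsub, hne, hmax⟩ :=
    exists_max_energy G (IsCliqueTuple G) c (c * ε ^ 2 / 4) hne₀
  have hα : 0 < c * ε ^ 2 / 4 := by positivity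
  have hpos := boxVolume_pos hne
  have hlog : Real.log (boxVolume W) ≤ Real.log (boxVolume W₀) :=
    Real.log_le_log hpos (boxVolume_mono hsub)
  have h0 := hmax W₀ (fun _ => subset_rfl) hne₀
  have hdens : n.factorial * γ ≤ tupleCount W₀ (IsCliqueTuple G) / boxVolume W₀ := by
    rw [le_div_iff₀ hv0]
    refine le_of_mul_le_mul_right ?_ (pow_pos hn' n)
    refine le_trans ?_ hT'
    rw [mul_assoc]
    gcongr
  have hcard : ∀ W' : Fin n → Finset V,
      c * ∑ p ∈ offDiagPairs (Fin n), pairDensity G W' p.1 p.2 ^ 2 ≤ γ := by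
    intro W'
    calc _ ≤ c * (Fintype.card (Fin n) : ℝ) ^ 2 := by
          gcongr; exact sum_sq_pairDensity_le G W'
      _ = γ := by rw [hc, Fintype.card_fin]; field_simp
  have hE₀ : n.factorial * γ ≤ energy G (IsCliqueTuple G) c W₀ :=
    hdens.trans (le_add_of_nonneg_right
      (mul_nonneg hc0.le (Finset.sum_nonneg fun _ _ => sq_nonneg _)))
  have hE : n.factorial * γ ≤ energy G (IsCliqueTuple G) c W := by
    have := mul_le_mul_of_nonneg_left hlog hα.le
    linarith
  refine ⟨W, fun i j hij => (hdisj i j hij).mono (hsub i) (hsub j), hne, fun i j hij =>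
    cutRegular_of_max hc0 hε0.le hne
      (fun W' h1 h2 => hmax W' (fun i => (h1 i).trans (hsub i)) h2) hij, ?_, ?_⟩
  · have := hcard W
    rw [energy] at hE
    linarith
  · have hE2 : energy G (IsCliqueTuple G) c W ≤ 2 := by
      have h1 := hcard W
      have h2 : tupleCount W (IsCliqueTuple G) / boxVolume W ≤ 1 :=
        div_le_one_of_le₀ (tupleCount_le _ _) hpos.le
      rw [energy]
      linarith
    have hE0 : 0 ≤ energy G (IsCliqueTuple G) c W₀ := le_trans (by positivity) hE₀
    -- The energy lies between 0 and 2, so maximality caps the loss of log-volume at 2/α.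
    have h1 : c * ε ^ 2 / 4 * (Real.log (boxVolume W₀) - Real.log (boxVolume W)) ≤ 2 := by
      linarith
    have h2 : Real.log (boxVolume W₀) - 32 * (n : ℝ) ^ 6 / γ ^ 3 ≤ Real.log (boxVolume W) := by
      rw [← le_div_iff₀' hα] at h1
      have : 2 / (c * ε ^ 2 / 4) = 32 * (n : ℝ) ^ 6 / γ ^ 3 := by
        rw [hc, hε]; field_simp; norm_num
      linarith
    have h3 : Real.exp (-(32 * (n : ℝ) ^ 6 / γ ^ 3)) * boxVolume W₀ ≤ boxVolume W := by
      have := Real.exp_le_exp.2 h2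
      rwa [Real.exp_log hpos, sub_eq_neg_add, Real.exp_add, Real.exp_log hv0] at this
    have h4 : γ * (Fintype.card V : ℝ) ^ n ≤ boxVolume W₀ * (n : ℝ) ^ n := by
      calc γ * (Fintype.card V : ℝ) ^ n ≤ n.factorial * γ * (Fintype.card V : ℝ) ^ n := by
            gcongr
            exact le_mul_of_one_le_left hγ.le hf
        _ ≤ _ := hT'
        _ ≤ _ := by gcongr; exact tupleCount_le _ _
    calc _ = Real.exp (-(32 * (n : ℝ) ^ 6 / γ ^ 3)) * (γ * (Fintype.card V : ℝ) ^ n) := by ring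
      _ ≤ Real.exp (-(32 * (n : ℝ) ^ 6 / γ ^ 3)) * (boxVolume W₀ * (n : ℝ) ^ n) := by gcongr
      _ = (Real.exp (-(32 * (n : ℝ) ^ 6 / γ ^ 3)) * boxVolume W₀) * (n : ℝ) ^ n := by ring
      _ ≤ _ := by gcongr

theorem le_card_of_le_boxVolume {k : ℕ} {V : Type*} [Fintype V] [Nonempty V]
    {W : Fin (k + 1) → Finset V} {ζ : ℝ}
    (h : ζ * (Fintype.card V : ℝ) ^ (k + 1) ≤ boxVolume W) (i : Fin (k + 1)) :
    ζ * Fintype.card V ≤ (W i).card := by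
  have hN : (0 : ℝ) < Fintype.card V := by exact_mod_cast Fintype.card_pos
  have h1 : boxVolume W ≤ (W i).card * (Fintype.card V : ℝ) ^ k := by
    rw [boxVolume, Fin.prod_univ_succAbove _ i]
    gcongr
    calc _ ≤ ∏ _j : Fin k, (Fintype.card V : ℝ) :=
          Finset.prod_le_prod (fun _ _ => Nat.cast_nonneg _)
            fun j _ => by exact_mod_cast Finset.card_le_univ _
      _ = _ := by simp
  refine le_of_mul_le_mul_right ?_ (pow_pos hN k)
  calc _ = ζ * (Fintype.card V : ℝ) ^ (k + 1) := by ring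
    _ ≤ _ := h.trans h1

theorem lemma5p1 (k : ℕ) (hk : 2 ≤ k) (γ : ℝ) (hγ_pos : 0 < γ) (hγ_le : γ ≤ 1 / 2) :
    ∃ ζ : ℝ, γ ^ ((k : ℝ) ^ (50 : ℕ) * (γ ^ (10 : ℕ))⁻¹) ≤ ζ ∧
      ∀ (V : Type*) [Fintype V] [DecidableEq V] [Nonempty V]
        (G : SimpleGraph V) [DecidableRel G.Adj],
        γ * (Fintype.card V : ℝ) ^ (k + 1) ≤ ((G.cliqueFinset (k + 1)).card : ℝ) →
        ∃ M : MixedGraph k V,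
          (∀ i, ⌊ζ * (Fintype.card V : ℝ)⌋₊ ≤ (M.A i).card) ∧
          ⌊ζ * (Fintype.card V : ℝ)⌋₊ ≤ M.C.card ∧
          M.graph ≤ G ∧
          (∀ e ∈ M.edges, G.IsNClique k (Finset.univ.image e)) ∧
          ∃ τ : ℝ, γ ^ ((2 : ℝ) / ((k : ℝ) + 1)) ≤ τ ∧ τ ≤ 1 / 2 ∧
            τ ≤ M.minExtDensity ∧ γ / 4 ≤ M.density * τ := by
  refine ⟨_, le_rfl, ?_⟩
  intro V _ _ _ G _ hG
  have hn3 : 3 ≤ k + 1 := by omega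
  obtain ⟨W, hdisj, hne, hreg, hT, hvol⟩ := exists_cutRegular_parts G (n := k + 1)
    (Nat.succ_pos k) hγ_pos hγ_le (by convert hG)
  set n : ℝ := ((k + 1 : ℕ) : ℝ) with hn
  have hn0 : 0 < n := by rw [hn]; positivity
  have hfac : (6 : ℝ) ≤ (k + 1).factorial := by exact_mod_cast six_le_factorial hn3
  have hfγ : 6 * γ ≤ (k + 1).factorial * γ := by gcongr
  have hsize : ∀ i, ⌊γ ^ ((k : ℝ) ^ (50 : ℕ) * (γ ^ (10 : ℕ))⁻¹) * (Fintype.card V : ℝ)⌋₊ ≤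
      (W i).card := by
    intro i
    refine Nat.floor_le_of_le (le_card_of_le_boxVolume ?_ i)
    refine le_of_mul_le_mul_right ?_ (pow_pos hn0 (k + 1))
    refine le_trans ?_ hvol
    rw [mul_right_comm]
    exact mul_le_mul_of_nonneg_right (rpow_le_exp_mul hk hγ_pos hγ_le) (by positivity)
  have hprod := tupleCount_isCliqueTuple_le (G := G) (by positivity) hne hreg
  have herr : n ^ 2 * (γ / (2 * n ^ 2)) = γ / 2 := by field_simp
  rw [← hn, herr] at hprod
  set D := ∏ p ∈ ltPairs (k + 1), pairDensity G W p.1 p.2 with hD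
  -- The losses γ and γ/2 fit since n! ≥ 6.
  have hDle : (k + 1).factorial * γ / 2 ≤ D := by linarith
  obtain ⟨c, -, hc⟩ := Finset.exists_max_image Finset.univ (starDensity G W)
    ⟨0, Finset.mem_univ _⟩
  have hpD : D ^ 2 ≤ starDensity G W c ^ (k + 1) := by
    rw [hD, ← prod_starDensity]
    calc ∏ i, starDensity G W i ≤ ∏ _i : Fin (k + 1), starDensity G W c :=
          Finset.prod_le_prod (fun i _ => starDensity_nonneg G W i) hc
      _ = _ := by simp
  have hp0 := starDensity_nonneg G W c
  have hτ := two_mul_rpow_le hn3 hγ_pos hp0 hDle hpD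
  have hdens := le_density_cliqueMixedGraph hdisj hne hreg c
  have hkε : k * (γ / (2 * n ^ 2)) ≤ γ / 6 := by
    have hkn : (k : ℝ) * 3 ≤ n ^ 2 := by
      have : k * 3 ≤ (k + 1) ^ 2 := by nlinarith
      rw [hn]; exact_mod_cast this
    rw [mul_div_assoc', div_le_div_iff₀ (by positivity) (by norm_num)]
    nlinarith
  set M := cliqueMixedGraph G W hdisj c (starDensity G W c / 2) with hM
  have hMd : 9 / 2 * γ ≤ M.density * starDensity G W c := by linarith
  -- Needed because the minimum extension density defaults to 0 without edges.
  have hedges : M.edges.Nonempty := by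
    rw [Finset.nonempty_iff_ne_empty]
    intro h0
    have : M.density = 0 := by simp [MixedGraph.density, h0]
    rw [this] at hMd
    linarith
  refine ⟨M, fun i => hsize _, hsize c, fun u v h => h.1, fun e he => ?_,
    starDensity G W c / 2, ?_, ?_, ?_, ?_⟩
  · exact isNClique_image_of_isCliqueTuple (isCliqueTuple_of_mem_edges he)
  · rwa [Nat.cast_succ] at hτ
  · linarith [starDensity_le_one G W c]
  · exact le_minExtDensity_cliqueMixedGraph hdisj c (hne c) _ hedges
  · linarith
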